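/- Let $p$ be a prime. A pro-$p$ group is a compact, totally disconnected topological group all of whose open normal subgroups have index a power of $p$. "Subgroup" means closed subgroup, "finitely generated" means topologically finitely generated, and the abelianization of $H$ is $H^{ab}=H/\overline{[H,H]}$. For a subgroup $H$ of a pro-$p$ group $G$ put $\Phi(H)=\overline{H^p[H,H]}$, where $H^p$ is the subgroup generated by the $p$-th powers of elements of $H$. The group $G$ is called *strongly Frattini-resistant* if for all subgroups $H,K$ of $G$ one has $\Phi(H)\le\Phi(K)\Leftrightarrow H\le K$, and *Frattini-resistant* if this holds for all finitely generated subgroups $H,K$ of $G$. It is called *absolutely torsion-free* if $H^{ab}$ is torsion-free for every subgroup $H$ of $G$, and *locally absolutely torsion-free* if $H^{ab}$ is torsion-free for every finitely generated subgroup $H$ of $G$. **Theorem A.** Let $G_1$ and $G_2$ be non-trivial pro-$p$ groups. (i) $G_1\times G_2$ is Frattini-resistant if and only if one of the groups $G_1$, $G_2$ is torsion-free abelian and the other one is locally absolutely torsion-free; in this case $G_1\times G_2$ is locally absolutely torsion-free. (ii) $G_1\times G_2$ is strongly Frattini-resistant if and only if one of the groups $G_1$, $G_2$ is torsion-free abelian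 and the other one is absolutely torsion-free; in this case $G_1\times G_2$ is absolutely torsion-free. -/

import Mathlib

namespace ProP

/-- A topological group is pro-`p` if it is compact and totally disconnected (hence Hausdorff),
and every open normal subgroup has index a power of `p`. -/
structure IsProP (p : ℕ) (G : Type*) [Group G] [TopologicalSpace G] [IsTopologicalGroup G] :
    Prop where
  compactSpace : CompactSpace G
  totallyDisconnectedSpace : TotallyDisconnectedSpace G
  index_eq_pow : ∀ U : Subgroup G, U.Normal → IsOpen (U : Set G) → ∃ n : ℕ, U.index = p ^ n

section

variable {G : Type*} [Group G] [TopologicalSpace G] [IsTopologicalGroup G]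

/-- The Frattini function: `Φ(H)` is the closure of `H ^ p [H, H]`, where `H ^ p` is the subgroup
generated by the `p`-th powers of elements of `H`. -/
def frattiniFun (p : ℕ) (H : Subgroup G) : Subgroup G :=
  (Subgroup.closure {y : G | ∃ x ∈ H, y = x ^ p} ⊔ ⁅H, H⁆).topologicalClosure

/-- `H` is a closed subgroup that is topologically generated by a finite set. -/
def IsTopFG (H : Subgroup G) : Prop :=
  ∃ S : Finset G, (Subgroup.closure (S : Set G)).topologicalClosure = H

end

section

variable (p : ℕ) (G : Type*) [Group G] [TopologicalSpace G] [IsTopologicalGroup G]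

/-- The Frattini function is an order embedding on the poset of topologically finitely generated
closed subgroups. -/
def IsFrattiniResistant : Prop :=
  ∀ H K : Subgroup G, IsTopFG H → IsTopFG K → (frattiniFun p H ≤ frattiniFun p K ↔ H ≤ K)

/-- The Frattini function is an order embedding on the poset of all closed subgroups. -/
def IsStronglyFrattiniResistant : Prop :=
  ∀ H K : Subgroup G, IsClosed (H : Set G) → IsClosed (K : Set G) →
    (frattiniFun p H ≤ frattiniFun p K ↔ H ≤ K)

/-- Every closed subgroup `H` has torsion-free abelianization; the abelianization in the sense of
topological groups is the quotient of `H` by the closure of its commutator subgroup. -/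
def IsAbsolutelyTorsionFree : Prop :=
  ∀ H : Subgroup G, IsClosed (H : Set G) → IsMulTorsionFree (TopologicalAbelianization H)

/-- Every topologically finitely generated closed subgroup has torsion-free abelianization. -/
def IsLocallyAbsolutelyTorsionFree : Prop :=
  ∀ H : Subgroup G, IsTopFG H → IsMulTorsionFree (TopologicalAbelianization H)

end

/-- The group is abelian and has no nontrivial element of finite order. -/
def IsTorsionFreeAbelian (G : Type*) [Group G] : Prop :=
  (∀ x y : G, x * y = y * x) ∧ ∀ x : G, IsOfFinOrder x → x = 1

end ProP

/-! Both parts come down to root extraction. Comparing Φ(K) with Φ of the procyclic group of y shows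
that (strong) Frattini-resistance means: y ^ p ∈ Φ(K) forces y ∈ K (`HasFrattiniRoots`). In a pro-p
group torsion-freeness is absence of p-torsion, so the torsion conditions become
`HasCommutatorRoots`. The parameter `fin` proves (i) and (ii) at once: `True` gives the finitely
generated subgroups, `False` all closed ones.

Commutator roots imply Frattini roots: if y ^ p ∈ Φ(K) and L is generated by K and y, then y ^ p = k
^ p in the torsion-free group L^ab for some k ∈ K, so K maps onto L^ab and K = L. Commutator roots
also pass to the product with a torsion-free abelian factor. This settles one direction and the
additional claims.

For the converse, a torsion class x in H^ab, with H ≤ G₂, is detected by a character χ of p-power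
order. Twisting generators of H by powers of a non-trivial a ∈ G₁ according to χ gives a subgroup K
whose Φ contains (1, x) ^ p although K omits (1, x) (`HasFrattiniRoots.hasCommutatorRoots_right`).
Hence both factors have commutator roots. If neither were abelian, non-commuting pairs a, b and c, d
would yield Heisenberg-type finite quotients (`IsProP.exists_heisenberg_quotient`), in which a
diagonal subgroup contradicts root extraction (`not_hasFrattiniRoots_prod_of_generators`). -/

namespace ProP

open Subgroup
open scoped Topology commutatorElement

/-! ### Pro-p groups: separation by open normal subgroups and p-torsion -/

section Profinite

theorem isClosed_map {G G' : Type*} [Group G] [TopologicalSpace G] [Group G']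
    [TopologicalSpace G'] [CompactSpace G] [T2Space G'] (f : G →* G') (hf : Continuous f)
    {H : Subgroup G} (hH : IsClosed (H : Set G)) : IsClosed (H.map f : Set G') := by
  rw [coe_map]
  exact (hH.isCompact.image hf).isClosed

variable {G G' : Type*} [Group G] [TopologicalSpace G] [IsTopologicalGroup G]
  [Group G'] [TopologicalSpace G'] [IsTopologicalGroup G']

theorem map_topologicalClosure [CompactSpace G] [T2Space G'] (f : G →* G') (hf : Continuous f)
    (H : Subgroup G) : H.topologicalClosure.map f = (H.map f).topologicalClosure := by
  apply SetLike.coe_injective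
  simp only [coe_map, topologicalClosure_coe]
  exact image_closure_of_isCompact isClosed_closure.isCompact hf.continuousOn

theorem topologicalClosure_eq_self {H : Subgroup G} (hH : IsClosed (H : Set G)) :
    H.topologicalClosure = H :=
  le_antisymm (topologicalClosure_minimal H le_rfl hH) (le_topologicalClosure H)

/-- A point outside a closed subgroup can be separated from it modulo an open normal subgroup. -/
theorem exists_open_normal_notMem_mul [CompactSpace G] [TotallyDisconnectedSpace G]
    {H : Subgroup G} (hH : IsClosed (H : Set G)) {x : G} (hx : x ∉ H) :
    ∃ V : Subgroup G, V.Normal ∧ IsOpen (V : Set G) ∧ x ∉ H ⊔ V := by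
  have ho : IsOpen ((fun g => x * g) ⁻¹' ((H : Set G)ᶜ)) :=
    hH.isOpen_compl.preimage (continuous_const_mul x)
  obtain ⟨V, hV⟩ := ProfiniteGrp.exist_openNormalSubgroup_sub_open_nhds_of_one ho (by simpa using hx)
  have hn : V.toSubgroup.Normal := V.isNormal'
  refine ⟨V.toSubgroup, hn, V.isOpen', fun h => ?_⟩
  obtain ⟨k, hk, v, hv, rfl⟩ := mem_sup_of_normal_right.mp h
  have := hV (inv_mem hv : v⁻¹ ∈ V.toSubgroup)
  simp [hk] at this

theorem exists_open_normal_ge_notMem [CompactSpace G] [TotallyDisconnectedSpace G]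
    {N : Subgroup G} [N.Normal] (hN : IsClosed (N : Set G)) {x : G} (hx : x ∉ N) :
    ∃ W : Subgroup G, W.Normal ∧ IsOpen (W : Set G) ∧ N ≤ W ∧ x ∉ W := by
  obtain ⟨V, hV, hVo, hxV⟩ := exists_open_normal_notMem_mul hN hx
  exact ⟨N ⊔ V, inferInstance, isOpen_mono le_sup_right hVo, le_sup_left, hxV⟩

theorem IsProP.isPGroup_quotient {p : ℕ} (hG : IsProP p G) (U : Subgroup G) [hU : U.Normal]
    (ho : IsOpen (U : Set G)) : IsPGroup p (G ⧸ U) := by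
  obtain ⟨n, hn⟩ := hG.index_eq_pow U hU ho
  exact IsPGroup.of_card (by rw [← hn]; rfl)

theorem finite_quotient_of_isOpen [CompactSpace G] (U : Subgroup G) (ho : IsOpen (U : Set G)) :
    Finite (G ⧸ U) :=
  U.quotient_finite_of_isOpen ho

theorem IsProP.subgroup {p : ℕ} (hp : p.Prime) (hG : IsProP p G) {H : Subgroup G}
    (hH : IsClosed (H : Set G)) : IsProP p H := by
  have := hG.compactSpace
  have := hG.totallyDisconnectedSpace
  have := Fact.mk hp
  have hc : CompactSpace H := isCompact_iff_compactSpace.mp hH.isCompact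
  refine ⟨hc, inferInstance, fun U hU ho => ?_⟩
  obtain ⟨O, hO, hOU⟩ := isOpen_induced_iff.mp ho
  obtain ⟨V, hV⟩ := ProfiniteGrp.exist_openNormalSubgroup_sub_open_nhds_of_one hO
    (by have : (1 : H) ∈ (U : Set H) := one_mem U
        rw [← hOU] at this; exact this)
  have hn : V.toSubgroup.Normal := V.isNormal'
  have hle : V.toSubgroup.subgroupOf H ≤ U := fun h hh => by
    have : h ∈ (U : Set H) := by rw [← hOU]; exact hV hh
    exact this
  have := finite_quotient_of_isOpen U ho
  have hP := hG.isPGroup_quotient V.toSubgroup V.isOpen'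
  have hP' : IsPGroup p (H ⧸ U) := fun g => by
    obtain ⟨h, rfl⟩ := QuotientGroup.mk_surjective g
    obtain ⟨k, hk⟩ := hP (QuotientGroup.mk (h : G))
    refine ⟨k, ?_⟩
    rw [← QuotientGroup.mk_pow, QuotientGroup.eq_one_iff] at hk ⊢
    exact hle (by simpa [mem_subgroupOf] using hk)
  exact IsPGroup.iff_card.mp hP'

/-- Modulo any open normal subgroup x has p-power order, so by Bézout x is a power of x ^ n there;
closedness of M lifts this to the group. -/
theorem mem_of_coprime_pow_mem {p : ℕ} (hG : IsProP p G) {M : Subgroup G}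
    (hM : IsClosed (M : Set G)) {n : ℕ} (hn : n.Coprime p) {x : G} (hx : x ^ n ∈ M) : x ∈ M := by
  have := hG.compactSpace
  have := hG.totallyDisconnectedSpace
  by_contra hxM
  obtain ⟨V, hV, hVo, hxV⟩ := exists_open_normal_notMem_mul hM hxM
  apply hxV
  obtain ⟨k, hk⟩ := hG.isPGroup_quotient V hVo (QuotientGroup.mk x)
  rw [← QuotientGroup.mk_pow, QuotientGroup.eq_one_iff] at hk
  have hc : IsCoprime (n : ℤ) ((p ^ k : ℕ) : ℤ) :=
    Nat.isCoprime_iff_coprime.mpr (Nat.Coprime.pow_right k hn)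
  obtain ⟨a, b, hab⟩ := hc
  have : x = (x ^ n) ^ a * (x ^ p ^ k) ^ b := by
    rw [← zpow_natCast, ← zpow_natCast x, ← zpow_mul, ← zpow_mul, ← zpow_add, mul_comm (n : ℤ),
      mul_comm _ b, hab, zpow_one]
  rw [this]
  exact mul_mem (zpow_mem (mem_sup_left hx) a) (zpow_mem (mem_sup_right hk) b)

theorem mem_of_pow_mem {p : ℕ} (hp : p.Prime) (hG : IsProP p G) {M : Subgroup G}
    (hM : IsClosed (M : Set G)) (h : ∀ x, x ^ p ∈ M → x ∈ M) {n : ℕ} (hn : n ≠ 0) {x : G}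
    (hx : x ^ n ∈ M) : x ∈ M := by
  obtain ⟨k, m, hm, rfl⟩ := Nat.exists_eq_pow_mul_and_not_dvd hn p hp.ne_one
  rw [mul_comm, pow_mul] at hx
  have key : ∀ (k : ℕ) (y : G), y ^ p ^ k ∈ M → y ∈ M := by
    intro k
    induction k with
    | zero => intro y hy; simpa using hy
    | succ k ih =>
      intro y hy
      rw [pow_succ, pow_mul] at hy
      exact ih y (h _ hy)
  exact mem_of_coprime_pow_mem hG hM ((Nat.Prime.coprime_iff_not_dvd hp).mpr hm).symm (key k _ hx)

theorem isMulTorsionFree_topologicalAbelianization_iff {p : ℕ} (hp : p.Prime) (hG : IsProP p G) :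
    IsMulTorsionFree (TopologicalAbelianization G) ↔
      ∀ x : G, x ^ p ∈ (commutator G).topologicalClosure →
        x ∈ (commutator G).topologicalClosure := by
  constructor
  · intro h x hx
    rw [← QuotientGroup.eq_one_iff] at hx ⊢
    exact h.pow_left_injective hp.ne_zero (by simpa using hx)
  · refine fun h => ⟨fun n hn a b hab => ?_⟩
    have hab : a ^ n = b ^ n := hab
    obtain ⟨g, hg⟩ := QuotientGroup.mk_surjective (a * b⁻¹)
    have h1 : (a * b⁻¹) ^ n = 1 := by rw [mul_pow, hab, ← mul_pow]; simp
    rw [← hg, ← QuotientGroup.mk_pow, QuotientGroup.eq_one_iff] at h1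
    have := mem_of_pow_mem hp hG (isClosed_topologicalClosure _) h hn h1
    rw [← QuotientGroup.eq_one_iff, hg] at this
    exact mul_inv_eq_one.mp this

theorem topologicalClosure_commutator_coe (H : Subgroup G) :
    (commutator H).topologicalClosure = ⁅H, H⁆.topologicalClosure.subgroupOf H := by
  rw [← map_subtype_commutator]
  apply SetLike.coe_injective
  simp only [topologicalClosure_coe, coe_subgroupOf, coe_map]
  exact Topology.IsInducing.subtypeVal.closure_eq_preimage_closure_image _

theorem isMulTorsionFree_subgroup_iff {p : ℕ} (hp : p.Prime) (hG : IsProP p G) {H : Subgroup G}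
    (hH : IsClosed (H : Set G)) : IsMulTorsionFree (TopologicalAbelianization H) ↔
      ∀ x ∈ H, x ^ p ∈ ⁅H, H⁆.topologicalClosure → x ∈ ⁅H, H⁆.topologicalClosure := by
  rw [isMulTorsionFree_topologicalAbelianization_iff hp (hG.subgroup hp hH),
    topologicalClosure_commutator_coe]
  simp [mem_subgroupOf]

end Profinite

/-! ### Resistance and torsion-freeness as root extraction -/

section Resistance

variable {G G' : Type*} [Group G] [TopologicalSpace G] [IsTopologicalGroup G]
  [Group G'] [TopologicalSpace G'] [IsTopologicalGroup G']

/-- `H` is topologically generated by a set, which has to be finite when `fin` holds. This treats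
closed subgroups and topologically finitely generated ones uniformly. -/
def IsTopGen (fin : Prop) (H : Subgroup G) : Prop :=
  ∃ S : Set G, (fin → S.Finite) ∧ (Subgroup.closure S).topologicalClosure = H

theorem IsTopGen.isClosed {fin : Prop} {H : Subgroup G} (h : IsTopGen fin H) :
    IsClosed (H : Set G) := by
  obtain ⟨S, -, rfl⟩ := h
  exact isClosed_topologicalClosure _

theorem isTopGen_true {H : Subgroup G} : IsTopGen True H ↔ IsTopFG H := by
  constructor
  · rintro ⟨S, hS, h⟩
    exact ⟨(hS trivial).toFinset, by simpa using h⟩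
  · rintro ⟨S, h⟩
    exact ⟨S, fun _ => S.finite_toSet, h⟩

theorem isTopGen_false {H : Subgroup G} : IsTopGen False H ↔ IsClosed (H : Set G) :=
  ⟨IsTopGen.isClosed, fun h => ⟨H, False.elim, by
    rw [closure_eq, topologicalClosure_eq_self h]⟩⟩

theorem IsTopGen.of_finite {fin : Prop} {S : Set G} (hS : S.Finite) :
    IsTopGen fin (Subgroup.closure S).topologicalClosure :=
  ⟨S, fun _ => hS, rfl⟩

theorem IsTopGen.map {fin : Prop} [CompactSpace G] [T2Space G'] (f : G →* G') (hf : Continuous f)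
    {H : Subgroup G} (h : IsTopGen fin H) : IsTopGen fin (H.map f) := by
  obtain ⟨S, hS, rfl⟩ := h
  exact ⟨f '' S, fun h => (hS h).image f, by
    rw [map_topologicalClosure f hf, MonoidHom.map_closure]⟩

/-- `Φ(K)` contains `y ^ p` only if `K` contains `y`. -/
def HasFrattiniRoots (fin : Prop) (p : ℕ) (G : Type*) [Group G] [TopologicalSpace G]
    [IsTopologicalGroup G] : Prop :=
  ∀ K : Subgroup G, IsTopGen fin K → ∀ y, y ^ p ∈ frattiniFun p K → y ∈ K

/-- The abelianizations of (finitely generated) closed subgroups have no `p`-torsion. -/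
def HasCommutatorRoots (fin : Prop) (p : ℕ) (G : Type*) [Group G] [TopologicalSpace G]
    [IsTopologicalGroup G] : Prop :=
  ∀ H : Subgroup G, IsTopGen fin H → ∀ x ∈ H, x ^ p ∈ ⁅H, H⁆.topologicalClosure →
    x ∈ ⁅H, H⁆.topologicalClosure

theorem pow_mem_frattiniFun {p : ℕ} {K : Subgroup G} {x : G} (hx : x ∈ K) :
    x ^ p ∈ frattiniFun p K :=
  le_topologicalClosure _ (mem_sup_left (subset_closure ⟨x, hx, rfl⟩))

theorem commutator_le_frattiniFun (p : ℕ) (K : Subgroup G) : ⁅K, K⁆ ≤ frattiniFun p K :=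
  le_sup_right.trans (le_topologicalClosure _)

theorem isClosed_frattiniFun (p : ℕ) (K : Subgroup G) : IsClosed (frattiniFun p K : Set G) :=
  isClosed_topologicalClosure _

theorem topologicalClosure_commutator_le_frattiniFun (p : ℕ) (K : Subgroup G) :
    ⁅K, K⁆.topologicalClosure ≤ frattiniFun p K :=
  topologicalClosure_minimal _ (commutator_le_frattiniFun p K) (isClosed_frattiniFun p K)

theorem frattiniFun_le {p : ℕ} {K N : Subgroup G} (hN : IsClosed (N : Set G))
    (hpow : ∀ x ∈ K, x ^ p ∈ N) (hcomm : ∀ x ∈ K, ∀ y ∈ K, ⁅x, y⁆ ∈ N) : frattiniFun p K ≤ N :=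
  topologicalClosure_minimal _ (sup_le ((closure_le _).mpr (by rintro _ ⟨x, hx, rfl⟩; exact hpow x hx))
    (commutator_le.mpr hcomm)) hN

theorem frattiniFun_mono (p : ℕ) {H K : Subgroup G} (h : H ≤ K) :
    frattiniFun p H ≤ frattiniFun p K :=
  frattiniFun_le (isClosed_frattiniFun p K) (fun _ hx => pow_mem_frattiniFun (h hx))
    fun _ hx _ hy => commutator_le_frattiniFun p K (commutator_mem_commutator (h hx) (h hy))

theorem map_frattiniFun (p : ℕ) [CompactSpace G] [T2Space G'] (f : G →* G') (hf : Continuous f)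
    (K : Subgroup G) : (frattiniFun p K).map f = frattiniFun p (K.map f) := by
  apply le_antisymm
  · rw [map_le_iff_le_comap]
    refine frattiniFun_le ((isClosed_frattiniFun p _).preimage hf) (fun x hx => ?_)
      fun x hx y hy => ?_
    · rw [mem_comap, map_pow]
      exact pow_mem_frattiniFun (mem_map_of_mem f hx)
    · rw [mem_comap, map_commutatorElement]
      exact commutator_le_frattiniFun p _
        (commutator_mem_commutator (mem_map_of_mem f hx) (mem_map_of_mem f hy))
  · refine frattiniFun_le (isClosed_map f hf (isClosed_frattiniFun p K)) ?_ ?_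
    · rintro _ ⟨x, hx, rfl⟩
      exact ⟨x ^ p, pow_mem_frattiniFun hx, map_pow f x p⟩
    · rintro _ ⟨x, hx, rfl⟩ _ ⟨y, hy, rfl⟩
      exact ⟨⁅x, y⁆, commutator_le_frattiniFun p K (commutator_mem_commutator hx hy),
        map_commutatorElement f x y⟩

theorem pow_mem_topologicalClosure_zpowers [T2Space G] {p : ℕ} {x y : G}
    (hy : y ∈ (zpowers x).topologicalClosure) {N : Subgroup G} (hN : IsClosed (N : Set G))
    (hx : x ^ p ∈ N) : y ^ p ∈ N := by
  have hc : IsClosed {g : G | g ^ p ∈ N} := hN.preimage (continuous_pow p)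
  refine closure_minimal ?_ hc hy
  rintro _ ⟨n, rfl⟩
  change (x ^ n) ^ p ∈ N
  rw [← zpow_natCast, ← zpow_mul, mul_comm, zpow_mul, zpow_natCast]
  exact zpow_mem hx n

theorem commute_of_mem_topologicalClosure_zpowers [T2Space G] {x y z : G}
    (hy : y ∈ (zpowers x).topologicalClosure) (hz : z ∈ (zpowers x).topologicalClosure) :
    Commute y z := by
  exact congrArg Subtype.val ((commGroupTopologicalClosure (zpowers x)
    (by rintro ⟨_, m, rfl⟩ ⟨_, n, rfl⟩
        exact Subtype.ext ((Commute.refl x).zpow_zpow m n))).mul_comm ⟨y, hy⟩ ⟨z, hz⟩)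

/-- Test resistance on the procyclic group topologically generated by y: it is abelian, so its Φ
lies in Φ(K) as soon as y ^ p does. -/
theorem frattiniFun_iff_hasFrattiniRoots [T2Space G] (fin : Prop) (p : ℕ) :
    (∀ H K : Subgroup G, IsTopGen fin H → IsTopGen fin K →
      (frattiniFun p H ≤ frattiniFun p K ↔ H ≤ K)) ↔ HasFrattiniRoots fin p G := by
  constructor
  · intro h K hK y hy
    have hY : IsTopGen fin (zpowers y).topologicalClosure := by
      rw [zpowers_eq_closure]; exact IsTopGen.of_finite (Set.finite_singleton y)
    refine (h _ K hY hK).mp (frattiniFun_le (isClosed_frattiniFun p K)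
      (fun x hx => pow_mem_topologicalClosure_zpowers hx (isClosed_frattiniFun p K) hy)
      fun x hx z hz => ?_) (le_topologicalClosure _ (mem_zpowers y))
    rw [commutatorElement_eq_one_iff_commute.mpr (commute_of_mem_topologicalClosure_zpowers hx hz)]
    exact one_mem _
  · intro h H K _ hK
    exact ⟨fun hle x hx => h K hK x (hle (pow_mem_frattiniFun hx)), frattiniFun_mono p⟩

theorem isFrattiniResistant_iff [T2Space G] (p : ℕ) :
    IsFrattiniResistant p G ↔ HasFrattiniRoots True p G := by
  rw [← frattiniFun_iff_hasFrattiniRoots]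
  simp only [isTopGen_true, IsFrattiniResistant]

theorem isStronglyFrattiniResistant_iff [T2Space G] (p : ℕ) :
    IsStronglyFrattiniResistant p G ↔ HasFrattiniRoots False p G := by
  rw [← frattiniFun_iff_hasFrattiniRoots]
  simp only [isTopGen_false, IsStronglyFrattiniResistant]

theorem isLocallyAbsolutelyTorsionFree_iff {p : ℕ} (hp : p.Prime) (hG : IsProP p G) :
    IsLocallyAbsolutelyTorsionFree G ↔ HasCommutatorRoots True p G :=
  forall_congr' fun _ => by
    rw [← isTopGen_true]
    exact forall_congr' fun hH => isMulTorsionFree_subgroup_iff hp hG hH.isClosed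

theorem isAbsolutelyTorsionFree_iff {p : ℕ} (hp : p.Prime) (hG : IsProP p G) :
    IsAbsolutelyTorsionFree G ↔ HasCommutatorRoots False p G :=
  forall_congr' fun _ => by
    rw [← isTopGen_false]
    exact forall_congr' fun hH => isMulTorsionFree_subgroup_iff hp hG hH.isClosed

/-- By compactness Φ commutes with continuous homomorphisms. This serves both to restrict to closed
subgroups and to swap the factors of a product. -/
theorem HasFrattiniRoots.of_injective {fin : Prop} {p : ℕ} [CompactSpace G] [T2Space G']
    (h : HasFrattiniRoots fin p G') (f : G →* G') (hf : Continuous f)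
    (hinj : Function.Injective f) : HasFrattiniRoots fin p G := fun K hK y hy =>
  (mem_map_iff_mem hinj).mp <| h _ (hK.map f hf) (f y) (by
    rw [← map_pow, ← map_frattiniFun p f hf]; exact mem_map_of_mem f hy)

theorem HasCommutatorRoots.of_injective {fin : Prop} {p : ℕ} [CompactSpace G] [T2Space G']
    (h : HasCommutatorRoots fin p G') (f : G →* G') (hf : Continuous f)
    (hinj : Function.Injective f) : HasCommutatorRoots fin p G := fun H hH x hx hxp => by
  have e : ⁅H.map f, H.map f⁆.topologicalClosure = ⁅H, H⁆.topologicalClosure.map f := by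
    rw [map_topologicalClosure f hf, map_commutator]
  have := h _ (hH.map f hf) (f x) (mem_map_of_mem f hx)
  rw [e, ← map_pow, mem_map_iff_mem hinj, mem_map_iff_mem hinj] at this
  exact this hxp

end Resistance

/-! ### Torsion-free abelianizations give Frattini roots -/

section TorsionFree

variable {G : Type*} [Group G] [TopologicalSpace G] [IsTopologicalGroup G]

/-- A maximal subgroup M of a finite p-group is normal, and F ⧸ M is solvable without proper
non-trivial subgroups, hence abelian. So every maximal subgroup contains the commutator subgroup. -/
theorem _root_.IsPGroup.eq_top_of_sup_commutator_eq_top {p : ℕ} (hp : p.Prime) {F : Type*}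
    [Group F] [Finite F] (hF : IsPGroup p F) {K : Subgroup F} (h : K ⊔ commutator F = ⊤) :
    K = ⊤ := by
  have := Fact.mk hp
  by_contra hK
  obtain ⟨M, hM, hle⟩ := (eq_top_or_exists_le_coatom K).resolve_left hK
  have hnil : Group.IsNilpotent F := hF.isNilpotent
  have hn : M.Normal := Group.normalizerCondition_of_isNilpotent.normal_of_coatom M hM
  have hnt : Nontrivial (F ⧸ M) := QuotientGroup.nontrivial_iff.mpr hM.1
  have hlt := Group.IsSolvable.commutator_lt_top_of_nontrivial (F ⧸ M)
  have hMC : M ≤ (commutator (F ⧸ M)).comap (QuotientGroup.mk' M) := fun m hm => by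
    rw [mem_comap, QuotientGroup.mk'_apply, (QuotientGroup.eq_one_iff m).mpr hm]
    exact one_mem _
  have hC : (commutator (F ⧸ M)).comap (QuotientGroup.mk' M) ≠ ⊤ := fun e => hlt.ne (by
    rw [← map_comap_eq_self_of_surjective (QuotientGroup.mk'_surjective M) (commutator (F ⧸ M)), e,
      map_top_of_surjective _ (QuotientGroup.mk'_surjective M)])
  have hcomm : commutator F ≤ M := by
    rw [(hM.le_iff_eq hC).mp hMC |>.symm, ← map_le_iff_le_comap, commutator_def, map_commutator,
      commutator_def]
    exact commutator_mono le_top le_top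
  exact hM.1 (top_le_iff.mp (h ▸ sup_le hle hcomm))

/-- If K missed some y, it would still miss y modulo an open normal V, contradicting the finite case
in G ⧸ V. -/
theorem IsProP.eq_top_of_forall_mem_mul_commutator {p : ℕ} (hp : p.Prime) (hG : IsProP p G)
    {K : Subgroup G} (hK : IsClosed (K : Set G))
    (h : ∀ x, ∃ k ∈ K, k⁻¹ * x ∈ (commutator G).topologicalClosure) : K = ⊤ := by
  have := hG.compactSpace
  have := hG.totallyDisconnectedSpace
  by_contra hne
  obtain ⟨y, hy⟩ : ∃ y, y ∉ K := by
    by_contra! hall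
    exact hne (eq_top_iff.mpr fun x _ => hall x)
  obtain ⟨V, hV, hVo, hyV⟩ := exists_open_normal_notMem_mul hK hy
  have := finite_quotient_of_isOpen V hVo
  have hT : (commutator G).topologicalClosure ≤
      (commutator (G ⧸ V)).comap (QuotientGroup.mk' V) := by
    refine topologicalClosure_minimal _ ?_ (isClosed_of_isOpen _ (isOpen_mono (H₁ := V) ?_ hVo))
    · rw [← map_le_iff_le_comap, commutator_def, map_commutator, commutator_def]
      exact commutator_mono le_top le_top
    · intro v hv
      rw [mem_comap, QuotientGroup.mk'_apply, (QuotientGroup.eq_one_iff v).mpr hv]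
      exact one_mem _
  have htop : K.map (QuotientGroup.mk' V) ⊔ commutator (G ⧸ V) = ⊤ := by
    refine eq_top_iff.mpr fun g _ => ?_
    obtain ⟨x, rfl⟩ := QuotientGroup.mk'_surjective V g
    obtain ⟨k, hk, hkx⟩ := h x
    rw [← mul_inv_cancel_left k x, map_mul]
    exact mul_mem (mem_sup_left (mem_map_of_mem _ hk)) (mem_sup_right (hT hkx))
  have e := (hG.isPGroup_quotient V hVo).eq_top_of_sup_commutator_eq_top hp htop
  apply hyV
  have hy' : y ∈ (K.map (QuotientGroup.mk' V)).comap (QuotientGroup.mk' V) := by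
    rw [e]; trivial
  rwa [comap_map_eq, QuotientGroup.ker_mk'] at hy'

theorem IsProP.eq_top_of_pow_mem_frattiniFun {p : ℕ} (hp : p.Prime) (hG : IsProP p G)
    (htf : ∀ x : G, x ^ p ∈ (commutator G).topologicalClosure →
      x ∈ (commutator G).topologicalClosure)
    {K : Subgroup G} (hK : IsClosed (K : Set G)) {y : G} (hy : y ^ p ∈ frattiniFun p K)
    (hgen : ∀ L : Subgroup G, IsClosed (L : Set G) → K ≤ L → y ∈ L → L = ⊤) : K = ⊤ := by
  have := hG.compactSpace
  have := hG.totallyDisconnectedSpace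
  have hcl : IsClosed ((commutator G).topologicalClosure : Set G) := isClosed_topologicalClosure _
  let q : G →* TopologicalAbelianization G := QuotientGroup.mk' _
  have hq : Continuous q := QuotientGroup.continuous_mk
  have hKq : IsClosed (K.map q : Set (TopologicalAbelianization G)) := isClosed_map q hq hK
  have hq1 : ∀ x : G, q x = 1 ↔ x ∈ (commutator G).topologicalClosure := QuotientGroup.eq_one_iff
  let P : Subgroup (TopologicalAbelianization G) := (K.map q).map (powMonoidHom p)
  have hP : IsClosed (P : Set (TopologicalAbelianization G)) :=
    isClosed_map (powMonoidHom p) (continuous_pow p) hKq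
  -- In an abelian group the p-th powers of elements of a subgroup already form a subgroup, closed
  -- here by compactness. So the image of y ^ p is the p-th power of a single q k.
  have hΦ : frattiniFun p K ≤ P.comap q := by
    refine frattiniFun_le (hP.preimage hq)
      (fun x hx => ⟨q x, mem_map_of_mem q hx, (map_pow q x p).symm⟩) fun x hx z hz => ?_
    rw [mem_comap, map_commutatorElement, commutatorElement_eq_one_iff_commute.mpr (Commute.all _ _)]
    exact one_mem _
  obtain ⟨_, ⟨k, hk, rfl⟩, hky⟩ := hΦ hy
  have hky : q k ^ p = q (y ^ p) := hky
  have hk' : k⁻¹ * y ∈ (commutator G).topologicalClosure := by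
    apply htf
    rw [← hq1, map_pow, map_mul, map_inv, mul_pow, inv_pow, hky, map_pow, inv_mul_cancel]
  have htop := hgen ((K.map q).comap q) (hKq.preimage hq) (le_comap_map q K)
    ⟨k, hk, by rw [← inv_mul_eq_one, ← map_inv, ← map_mul, hq1]; exact hk'⟩
  refine hG.eq_top_of_forall_mem_mul_commutator hp hK fun x => ?_
  obtain ⟨c, hc, hcx⟩ : x ∈ (K.map q).comap q := by rw [htop]; trivial
  exact ⟨c, hc, by rw [← hq1, map_mul, map_inv, hcx, inv_mul_cancel]⟩

/-- Adjoining y to K gives L, which needs at most one more generator and so stays in the class where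
the hypothesis applies; the argument then runs inside L. -/
theorem HasCommutatorRoots.hasFrattiniRoots {fin : Prop} {p : ℕ} (hp : p.Prime) (hG : IsProP p G)
    (h : HasCommutatorRoots fin p G) : HasFrattiniRoots fin p G := by
  have := hG.compactSpace
  have := hG.totallyDisconnectedSpace
  rintro K ⟨S, hS, hSK⟩ y hy
  obtain ⟨L, hL⟩ : ∃ L, (Subgroup.closure (insert y S)).topologicalClosure = L := ⟨_, rfl⟩
  have hLgen : IsTopGen fin L := ⟨_, fun hf => (hS hf).insert y, hL⟩
  have hSL : insert y S ⊆ L := by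
    rw [← hL]; exact subset_closure.trans (le_topologicalClosure _)
  have hKL : K ≤ L := by
    rw [← hSK]
    exact topologicalClosure_minimal _
      ((closure_le L).mpr ((Set.subset_insert y S).trans hSL)) hLgen.isClosed
  have hyL : y ∈ L := hSL (Set.mem_insert y S)
  have hKc : IsClosed (K : Set G) := hSK ▸ isClosed_topologicalClosure _
  have hLp := hG.subgroup hp hLgen.isClosed
  have := hLp.compactSpace
  have htop : K.subgroupOf L = ⊤ := by
    refine hLp.eq_top_of_pow_mem_frattiniFun hp (fun x hx => ?_)
      (hKc.preimage continuous_subtype_val) (y := ⟨y, hyL⟩) ?_ fun L' hL' hKL' hyL' => ?_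
    · rw [topologicalClosure_commutator_coe] at hx ⊢
      exact h L hLgen x x.2 hx
    · have hm : (⟨y, hyL⟩ ^ p : L).1 ∈ (frattiniFun p (K.subgroupOf L)).map L.subtype := by
        rw [map_frattiniFun p L.subtype continuous_subtype_val, map_subgroupOf_eq_of_le hKL]
        exact hy
      exact (mem_map_iff_mem L.subtype_injective).mp hm
    · have hLm : L ≤ L'.map L.subtype := by
        conv_lhs => rw [← hL]
        refine topologicalClosure_minimal _ ((closure_le _).mpr (Set.insert_subset ?_ fun s hs => ?_))
          (isClosed_map L.subtype continuous_subtype_val hL')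
        · exact ⟨⟨y, hyL⟩, hyL', rfl⟩
        · have hsK : s ∈ K := hSK ▸ le_topologicalClosure _ (subset_closure hs)
          exact ⟨⟨s, hKL hsK⟩, hKL' hsK, rfl⟩
      refine eq_top_iff.mpr fun x _ => ?_
      exact (mem_map_iff_mem L.subtype_injective).mp (hLm x.2)
  exact subgroupOf_eq_top.mp htop hyL

end TorsionFree

/-! ### Products and their commutator subgroups -/

section Prod

variable {G₁ G₂ : Type*} [Group G₁] [TopologicalSpace G₁] [IsTopologicalGroup G₁]
  [Group G₂] [TopologicalSpace G₂] [IsTopologicalGroup G₂]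

theorem IsProP.prod {p : ℕ} (hp : p.Prime) (h₁ : IsProP p G₁) (h₂ : IsProP p G₂) :
    IsProP p (G₁ × G₂) := by
  have := h₁.compactSpace
  have := h₂.compactSpace
  have := h₁.totallyDisconnectedSpace
  have := h₂.totallyDisconnectedSpace
  have := Fact.mk hp
  refine ⟨inferInstance, inferInstance, fun U hU ho => ?_⟩
  have hf := finite_quotient_of_isOpen U ho
  refine (IsPGroup.iff_card (G := (G₁ × G₂) ⧸ U)).mp fun g => ?_
  obtain ⟨⟨x, y⟩, rfl⟩ := QuotientGroup.mk_surjective g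
  have hx := h₁.isPGroup_quotient (U.comap (MonoidHom.inl G₁ G₂))
    (ho.preimage (Continuous.prodMk continuous_id continuous_const))
  have hy := h₂.isPGroup_quotient (U.comap (MonoidHom.inr G₁ G₂))
    (ho.preimage (Continuous.prodMk continuous_const continuous_id))
  obtain ⟨k, hk⟩ := hx (QuotientGroup.mk x)
  obtain ⟨l, hl⟩ := hy (QuotientGroup.mk y)
  rw [← QuotientGroup.mk_pow, QuotientGroup.eq_one_iff, mem_comap] at hk hl
  refine ⟨k + l, ?_⟩
  rw [← QuotientGroup.mk_pow, QuotientGroup.eq_one_iff]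
  have e : ((x, y) : G₁ × G₂) ^ p ^ (k + l) = MonoidHom.inl G₁ G₂ (x ^ p ^ k) ^ p ^ l *
      MonoidHom.inr G₁ G₂ (y ^ p ^ l) ^ p ^ k := by
    simp [pow_add, ← pow_mul, mul_comm]
  rw [e]
  exact mul_mem (pow_mem hk _) (pow_mem hl _)

/-- As first coordinates commute, the commutator of two elements of H is (1, commutator of their
second coordinates). -/
theorem inr_mem_topologicalClosure_commutator {H : Subgroup (G₁ × G₂)}
    (hH : ∀ x ∈ H, ∀ y ∈ H, Commute x.1 y.1) {g : G₂}
    (hg : g ∈ ⁅H.map (MonoidHom.snd G₁ G₂), H.map (MonoidHom.snd G₁ G₂)⁆.topologicalClosure) :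
    ((1, g) : G₁ × G₂) ∈ ⁅H, H⁆.topologicalClosure := by
  have hle : ⁅H.map (MonoidHom.snd G₁ G₂), H.map (MonoidHom.snd G₁ G₂)⁆.topologicalClosure ≤
      ⁅H, H⁆.topologicalClosure.comap (MonoidHom.inr G₁ G₂) := by
    refine topologicalClosure_minimal _ (commutator_le.mpr ?_)
      ((isClosed_topologicalClosure _).preimage (Continuous.prodMk continuous_const continuous_id))
    rintro _ ⟨x, hx, rfl⟩ _ ⟨y, hy, rfl⟩
    have e : MonoidHom.inr G₁ G₂ ⁅x.2, y.2⁆ = ⁅x, y⁆ :=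
      Prod.ext (commutatorElement_eq_one_iff_commute.mpr (hH x hx y hy)).symm rfl
    rw [mem_comap]
    change MonoidHom.inr G₁ G₂ ⁅x.2, y.2⁆ ∈ _
    rw [e]
    exact le_topologicalClosure _ (commutator_mem_commutator hx hy)
  exact hle hg

theorem HasCommutatorRoots.prod {fin : Prop} {p : ℕ} [CompactSpace G₁] [CompactSpace G₂]
    [T2Space G₁] [T2Space G₂] (hcomm : ∀ x y : G₁, x * y = y * x)
    (htf : ∀ x : G₁, x ^ p = 1 → x = 1) (h : HasCommutatorRoots fin p G₂) :
    HasCommutatorRoots fin p (G₁ × G₂) := by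
  rintro H hH ⟨a, g⟩ hx hxp
  have hle : ⁅H, H⁆.topologicalClosure ≤
      (⊥ : Subgroup G₁).prod ⁅H.map (MonoidHom.snd G₁ G₂), H.map (MonoidHom.snd G₁ G₂)⁆.topologicalClosure := by
    refine topologicalClosure_minimal _ (commutator_le.mpr fun x hx y hy => ⟨?_, ?_⟩) ?_
    · exact commutatorElement_eq_one_iff_commute.mpr (hcomm x.1 y.1)
    · exact le_topologicalClosure _
        (commutator_mem_commutator (mem_map_of_mem _ hx) (mem_map_of_mem _ hy))
    · rw [coe_prod]
      exact IsClosed.prod isClosed_singleton (isClosed_topologicalClosure _)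
  obtain ⟨h1, h2⟩ := hle hxp
  obtain rfl : a = 1 := htf a h1
  exact inr_mem_topologicalClosure_commutator (fun x _ y _ => hcomm x.1 y.1)
    (h _ (hH.map (MonoidHom.snd G₁ G₂) continuous_snd) g ⟨_, hx, rfl⟩ h2)

end Prod

/-! ### Each factor inherits commutator roots: twisting by characters -/

/-- The element survives in a finite abelian quotient of p-power order, where complex characters
separate points. -/
theorem IsProP.exists_character {p : ℕ} {G : Type*} [Group G] [TopologicalSpace G]
    [IsTopologicalGroup G] (hG : IsProP p G) {x : G}
    (hx : x ∉ (commutator G).topologicalClosure) :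
    ∃ (χ : G →* ℂˣ) (k : ℕ), (∀ g, χ g ^ p ^ k = 1) ∧ IsOpen (χ.ker : Set G) ∧ χ x ≠ 1 := by
  have := hG.compactSpace
  have := hG.totallyDisconnectedSpace
  obtain ⟨W, hW, hWo, hTW, hxW⟩ :=
    exists_open_normal_ge_notMem (isClosed_topologicalClosure (commutator G)) hx
  obtain ⟨k, hk⟩ := hG.index_eq_pow W hW hWo
  have := finite_quotient_of_isOpen W hWo
  have hcomm : ∀ a b : G ⧸ W, a * b = b * a := fun a b => by
    obtain ⟨a, rfl⟩ := QuotientGroup.mk_surjective a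
    obtain ⟨b, rfl⟩ := QuotientGroup.mk_surjective b
    rw [← commute_iff_eq, ← commutatorElement_eq_one_iff_commute]
    exact (QuotientGroup.eq_one_iff ⁅a, b⁆).mpr
      (hTW (le_topologicalClosure _ (commutator_mem_commutator (mem_top a) (mem_top b))))
  let _ : CommGroup (G ⧸ W) := { (inferInstance : Group (G ⧸ W)) with mul_comm := hcomm }
  obtain ⟨φ, hφ⟩ := CommGroup.exists_apply_ne_one_of_hasEnoughRootsOfUnity (G ⧸ W) ℂ
    (a := QuotientGroup.mk x) (fun h => hxW ((QuotientGroup.eq_one_iff x).mp h))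
  refine ⟨φ.comp (QuotientGroup.mk' W), k, fun g => ?_, isOpen_mono (H₁ := W) (fun w hw => ?_) hWo,
    hφ⟩
  · rw [← map_pow, MonoidHom.comp_apply, QuotientGroup.mk'_apply,
      (QuotientGroup.eq_one_iff (g ^ p ^ k)).mpr (hk ▸ W.pow_index_mem g), map_one]
  · rw [MonoidHom.mem_ker, MonoidHom.comp_apply, QuotientGroup.mk'_apply,
      (QuotientGroup.eq_one_iff w).mpr hw, map_one]

variable {G₁ G₂ : Type*} [Group G₁] [TopologicalSpace G₁] [IsTopologicalGroup G₁]
  [Group G₂] [TopologicalSpace G₂] [IsTopologicalGroup G₂]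

theorem HasFrattiniRoots.eq_one_of_pow_eq_one {fin : Prop} {p : ℕ} [T1Space G₁]
    (h : HasFrattiniRoots fin p G₁) {g : G₁} (hg : g ^ p = 1) : g = 1 := by
  have hbot : IsTopGen fin (⊥ : Subgroup G₁) :=
    ⟨∅, fun _ => Set.finite_empty, by
      rw [Subgroup.closure_empty]
      exact topologicalClosure_eq_self isClosed_singleton⟩
  exact h ⊥ hbot g (hg ▸ one_mem _)

theorem HasFrattiniRoots.hasCommutatorRoots_right {fin : Prop} {p : ℕ} (hp : p.Prime)
    [Nontrivial G₁] (h₁ : IsProP p G₁) (h₂ : IsProP p G₂)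
    (h : HasFrattiniRoots fin p (G₁ × G₂)) : HasCommutatorRoots fin p G₂ := by
  have := h₁.compactSpace
  have := h₂.compactSpace
  have := h₁.totallyDisconnectedSpace
  have := h₂.totallyDisconnectedSpace
  intro H hH x hx hxp
  by_contra hxN
  obtain ⟨χ, k, hχ, hχo, hχx⟩ := (h₂.subgroup hp hH.isClosed).exists_character (x := ⟨x, hx⟩)
    (by rw [topologicalClosure_commutator_coe]; exact hxN)
  obtain ⟨a, ha⟩ := exists_ne (1 : G₁)
  have hak : ∀ k, a ^ p ^ k ≠ 1 := by
    intro k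
    induction k with
    | zero => simpa using ha
    | succ k ih =>
      intro e
      have := h.eq_one_of_pow_eq_one (g := (a ^ p ^ k, 1))
        (by rw [Prod.pow_mk, ← pow_mul, ← pow_succ, e, one_pow]; rfl)
      exact ih (congrArg Prod.fst this)
  -- U is chosen so that the order p ^ n of a modulo U is at least p ^ k; the values of χ are then
  -- powers of a root of unity ζ of exactly that order.
  obtain ⟨U, hU, hUo, -, haU⟩ :=
    exists_open_normal_ge_notMem (N := (⊥ : Subgroup G₁)) isClosed_singleton (hak k)
  obtain ⟨n, hn⟩ : ∃ n, orderOf (QuotientGroup.mk a : G₁ ⧸ U) = p ^ n := by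
    have := Fact.mk hp
    exact IsPGroup.iff_orderOf.mp (h₁.isPGroup_quotient U hUo) _
  have hkn : k ≤ n := by
    by_contra! hlt
    apply haU
    rw [← QuotientGroup.eq_one_iff, QuotientGroup.mk_pow, ← orderOf_dvd_iff_pow_eq_one, hn]
    exact pow_dvd_pow p hlt.le
  have hpn : p ^ n ≠ 0 := pow_ne_zero n hp.ne_zero
  obtain ⟨ζ, hζ⟩ : ∃ ζ : ℂˣ, IsPrimitiveRoot ζ (p ^ n) :=
    ⟨_, (Complex.isPrimitiveRoot_exp (p ^ n) hpn).isUnit_unit hpn⟩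
  have hex : ∀ g : H, ∃ m : ℤ, ζ ^ m = χ g := fun g => by
    have := NeZero.mk hpn
    have hmem : χ g ∈ zpowers ζ := by
      rw [hζ.zpowers_eq, mem_rootsOfUnity, ← Nat.add_sub_of_le hkn, pow_add, pow_mul, hχ, one_pow]
    exact hmem
  choose e he using hex
  obtain ⟨S, hS, hSH⟩ := hH
  have hSsub : S ⊆ H := hSH ▸ subset_closure.trans (le_topologicalClosure _)
  -- The exponents `e` need not be additive: only their values on generators matter. Twisting the
  -- generators makes the first coordinate modulo U determine χ of the second.
  let R : Set (G₁ × G₂) := (fun s : H => (a ^ e s, (s : G₂))) '' (Subtype.val ⁻¹' S)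
  have hR : fin → R.Finite := fun hf =>
    ((hS hf).preimage Subtype.val_injective.injOn).image _
  let K : Subgroup (G₁ × G₂) := (Subgroup.closure R).topologicalClosure
  have hKsnd : K.map (MonoidHom.snd G₁ G₂) = H := by
    rw [map_topologicalClosure _ continuous_snd, MonoidHom.map_closure, ← hSH]
    congr 2
    rw [Set.image_image]
    exact (Subtype.image_preimage_coe (H : Set G₂) S).trans (Set.inter_eq_right.mpr hSsub)
  have hKfst : K ≤ (zpowers a).topologicalClosure.comap (MonoidHom.fst G₁ G₂) := by
    refine topologicalClosure_minimal _ ((closure_le _).mpr ?_)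
      ((isClosed_topologicalClosure _).preimage continuous_fst)
    rintro _ ⟨s, -, rfl⟩
    exact le_topologicalClosure _ (zpow_mem (mem_zpowers a) _)
  have hxK : ((1, x) : G₁ × G₂) ∈ K := by
    refine h K ⟨R, hR, rfl⟩ _ (topologicalClosure_commutator_le_frattiniFun p K ?_)
    rw [Prod.pow_mk, one_pow]
    refine inr_mem_topologicalClosure_commutator (fun y hy z hz =>
      commute_of_mem_topologicalClosure_zpowers (hKfst hy) (hKfst hz)) ?_
    rwa [hKsnd]
  -- Every (g, w) in the abstract group generated by R satisfies g ≡ a ^ m modulo U and χ w = ζ ^ m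
  -- for a common m.
  have hRD : Subgroup.closure R ≤ ((zpowers ((QuotientGroup.mk a : G₁ ⧸ U), ζ)).comap
      ((QuotientGroup.mk' U).prodMap χ)).map ((MonoidHom.id G₁).prodMap H.subtype) := by
    rw [closure_le]
    rintro _ ⟨s, -, rfl⟩
    exact ⟨(a ^ e s, s), ⟨e s, Prod.ext rfl (he s)⟩, rfl⟩
  obtain ⟨O, hO, hOχ⟩ := isOpen_induced_iff.mp hχo
  have hmemO : ∀ g : H, (g : G₂) ∈ O ↔ χ g = 1 := fun g => by
    rw [← MonoidHom.mem_ker, ← SetLike.mem_coe, ← hOχ]; rfl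
  -- K is only a closure, so (1, x) is approximated by an element of the abstract group with first
  -- coordinate in U and the same χ-value as x.
  have hnhds : IsOpen {z : G₁ × G₂ | z.1 ∈ U ∧ x⁻¹ * z.2 ∈ O} :=
    (hUo.preimage continuous_fst).inter (hO.preimage (continuous_snd.const_mul x⁻¹))
  obtain ⟨z, ⟨hzU, hzO⟩, hz⟩ := mem_closure_iff.mp hxK _ hnhds
    ⟨one_mem U, by rw [inv_mul_cancel]; exact (hmemO 1).mpr (map_one χ)⟩
  obtain ⟨⟨g, w⟩, ⟨m, hm⟩, rfl⟩ := hRD hz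
  have hm1 : (QuotientGroup.mk a : G₁ ⧸ U) ^ m = QuotientGroup.mk g := congrArg Prod.fst hm
  have hm2 : ζ ^ m = χ w := congrArg Prod.snd hm
  have hzU : g ∈ U := hzU
  rw [(QuotientGroup.eq_one_iff g).mpr hzU, ← orderOf_dvd_iff_zpow_eq_one, hn] at hm1
  -- Since ζ and a modulo U have the same order, a trivial first coordinate forces χ w = 1.
  rw [(hζ.zpow_eq_one_iff_dvd m).mpr hm1] at hm2
  have hxw := (hmemO (⟨x, hx⟩⁻¹ * w)).mp hzO
  rw [map_mul, ← hm2, mul_one, map_inv, inv_eq_one] at hxw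
  exact hχx hxw

/-! ### Quotients of Heisenberg type -/

theorem _root_.commute_pow_of_commutatorElement_pow_eq_one {F : Type*} [Group F] {x g : F} {n : ℕ}
    (hc : Commute ⁅x, g⁆ x) (h : ⁅x, g⁆ ^ n = 1) : Commute (x ^ n) g := by
  have e : g * x * g⁻¹ = ⁅x, g⁆⁻¹ * x := by
    rw [commutatorElement_def]; group
  have e' : g * x ^ n * g⁻¹ = x ^ n := by
    rw [← conj_pow, e, hc.inv_left.mul_pow, inv_pow, h, inv_one, one_mul]
  exact (mul_inv_eq_iff_eq_mul.mp e').symm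

theorem _root_.zpow_eq_one_of_dvd {F : Type*} [Group F] {x : F} {m : ℕ} {n : ℤ} (hx : x ^ m = 1)
    (h : (m : ℤ) ∣ n) : x ^ n = 1 := by
  obtain ⟨k, rfl⟩ := h
  rw [zpow_mul, zpow_natCast, hx, one_zpow]

/-- In a product of two groups of Heisenberg type, the diagonal subgroup does not contain the
commutator of one factor. -/
theorem commutator_one_notMem_closure_pair {p : ℕ} (hp : p.Prime) {F₁ F₂ : Type*} [Group F₁]
    [Group F₂] {a b : F₁} {c d : F₂} (ha : a ^ p = 1) (hb : b ^ p = 1) (hc : c ^ p = 1)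
    (hd : d ^ p = 1) (hu : ∀ g, Commute ⁅a, b⁆ g) (hv : ∀ g, Commute ⁅c, d⁆ g)
    (hup : ⁅a, b⁆ ^ p = 1) (hvp : ⁅c, d⁆ ^ p = 1) (hab : ⁅a, b⁆ ≠ 1) (hcd : ⁅c, d⁆ ≠ 1) :
    ((⁅a, b⁆, 1) : F₁ × F₂) ∉ Subgroup.closure {(a, c), (b, d)} := by
  obtain ⟨A, hA⟩ : ∃ A : F₁ × F₂, A = (a, c) := ⟨_, rfl⟩
  obtain ⟨B, hB⟩ : ∃ B : F₁ × F₂, B = (b, d) := ⟨_, rfl⟩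
  have hC : ∀ g, Commute ⁅A, B⁆ g := by
    rintro ⟨g, h⟩
    subst hA hB
    exact Prod.ext (hu g) (hv h)
  have hBA : ∀ i j : ℤ, B ^ j * A ^ i = A ^ i * B ^ j * ⁅A, B⁆ ^ (-(i * j)) := by
    intro i j
    have h1 : A * B * A⁻¹ = ⁅A, B⁆ * B := by rw [commutatorElement_def]; group
    have h2 : A * B ^ j * A⁻¹ = ⁅A, B⁆ ^ j * B ^ j := by
      rw [← conj_zpow, h1, (hC B).mul_zpow]
    have h3 : B ^ j * A * (B ^ j)⁻¹ = ⁅A, B⁆ ^ (-j) * A := by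
      have : A * B ^ j = ⁅A, B⁆ ^ j * B ^ j * A := mul_inv_eq_iff_eq_mul.mp h2
      rw [mul_inv_eq_iff_eq_mul, mul_assoc, this, zpow_neg]
      group
    have h4 : B ^ j * A ^ i * (B ^ j)⁻¹ = ⁅A, B⁆ ^ (-(i * j)) * A ^ i := by
      rw [← conj_zpow, h3, ((hC A).zpow_left _).mul_zpow, ← zpow_mul]
      congr 2
      ring
    rw [mul_inv_eq_iff_eq_mul] at h4
    rw [h4, ((hC (A ^ i * B ^ j)).zpow_left _).eq.symm, mul_assoc]
  -- Normal form: ⁅A, B⁆ is central, so reordering A and B only costs powers of it.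
  have hnf : ∀ g ∈ Subgroup.closure {A, B}, ∃ i j m : ℤ, g = A ^ i * B ^ j * ⁅A, B⁆ ^ m := by
    intro g hg
    induction hg using Subgroup.closure_induction with
    | mem x hx =>
      rcases hx with rfl | rfl
      · exact ⟨1, 0, 0, by simp⟩
      · exact ⟨0, 1, 0, by simp⟩
    | one => exact ⟨0, 0, 0, by simp⟩
    | mul x y _ _ hx hy =>
      obtain ⟨i, j, m, rfl⟩ := hx
      obtain ⟨i', j', m', rfl⟩ := hy
      refine ⟨i + i', j + j', -(i' * j) + m + m', ?_⟩
      calc A ^ i * B ^ j * ⁅A, B⁆ ^ m * (A ^ i' * B ^ j' * ⁅A, B⁆ ^ m')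
          = A ^ i * B ^ j * (⁅A, B⁆ ^ m * (A ^ i' * B ^ j')) * ⁅A, B⁆ ^ m' := by group
        _ = A ^ i * (B ^ j * A ^ i') * B ^ j' * ⁅A, B⁆ ^ m * ⁅A, B⁆ ^ m' := by
            rw [((hC (A ^ i' * B ^ j')).zpow_left m).eq]; group
        _ = A ^ i * A ^ i' * B ^ j * (⁅A, B⁆ ^ (-(i' * j)) * B ^ j') * ⁅A, B⁆ ^ m *
              ⁅A, B⁆ ^ m' := by
            rw [hBA]; group
        _ = _ := by
            rw [((hC (B ^ j')).zpow_left _).eq, zpow_add A, zpow_add B, zpow_add ⁅A, B⁆,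
              zpow_add ⁅A, B⁆]
            group
    | inv x _ hx =>
      obtain ⟨i, j, m, rfl⟩ := hx
      refine ⟨-i, -j, -(i * j) - m, ?_⟩
      rw [mul_inv_rev, mul_inv_rev, ← zpow_neg, ← zpow_neg, ← zpow_neg, hBA,
        ((hC _).zpow_left (-m)).eq, sub_eq_add_neg, zpow_add, ← mul_assoc]
      congr 3
      ring
  intro hmem
  rw [← hA, ← hB] at hmem
  obtain ⟨i, j, m, h⟩ := hnf _ hmem
  subst hA hB
  have h1 : ⁅a, b⁆ = a ^ i * b ^ j * ⁅a, b⁆ ^ m := congrArg Prod.fst h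
  have h2 : 1 = c ^ i * d ^ j * ⁅c, d⁆ ^ m := congrArg Prod.snd h
  have hdvd : ∀ n : ℤ, ⁅c, d⁆ ^ n = 1 → (p : ℤ) ∣ n := fun n hn => by
    rw [← orderOf_eq_prime_iff (hp := ⟨hp⟩) |>.mpr ⟨hvp, hcd⟩]
    exact orderOf_dvd_iff_zpow_eq_one.mpr hn
  -- A trivial second coordinate makes c ^ i commute with d, and d ^ j with c, so ⁅c, d⁆ ^ i = ⁅c,
  -- d⁆ ^ j = 1. Thus p divides i and j, then m, and the first coordinate is trivial too.
  have hci : Commute (c ^ i) d := by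
    have : c ^ i = (d ^ j * ⁅c, d⁆ ^ m)⁻¹ := by
      rw [eq_inv_iff_mul_eq_one, ← mul_assoc, ← h2]
    rw [this]
    exact ((((Commute.refl d).zpow_left j).mul_left ((hv d).zpow_left m))).inv_left
  have hdj : Commute c (d ^ j) := by
    have : d ^ j = (c ^ i)⁻¹ * (⁅c, d⁆ ^ m)⁻¹ := by
      rw [← mul_inv_rev, eq_inv_iff_mul_eq_one, ← mul_assoc, mul_eq_one_iff_eq_inv,
        eq_comm, inv_eq_iff_mul_eq_one, ← mul_assoc, ← h2]
    rw [this]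
    exact (((Commute.refl c).zpow_right i).inv_right).mul_right ((hv c).zpow_left m).inv_left.symm
  have hpi : (p : ℤ) ∣ i := by
    apply hdvd
    have h1 : d * c * d⁻¹ = ⁅c, d⁆⁻¹ * c := by rw [commutatorElement_def]; group
    have h2 : d * c ^ i * d⁻¹ = ⁅c, d⁆⁻¹ ^ i * c ^ i := by
      rw [← conj_zpow, h1, (hv c).inv_left.mul_zpow]
    rw [← hci.eq, mul_inv_cancel_right, eq_comm, mul_eq_right, inv_zpow, inv_eq_one] at h2
    exact h2
  have hpj : (p : ℤ) ∣ j := by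
    apply hdvd
    have h1 : c * d * c⁻¹ = ⁅c, d⁆ * d := by rw [commutatorElement_def]; group
    have h2 : c * d ^ j * c⁻¹ = ⁅c, d⁆ ^ j * d ^ j := by
      rw [← conj_zpow, h1, (hv d).mul_zpow]
    rw [hdj.eq, mul_inv_cancel_right, eq_comm, mul_eq_right] at h2
    exact h2
  rw [zpow_eq_one_of_dvd hc hpi, zpow_eq_one_of_dvd hd hpj, one_mul, one_mul] at h2
  rw [zpow_eq_one_of_dvd ha hpi, zpow_eq_one_of_dvd hb hpj, zpow_eq_one_of_dvd hup (hdvd m h2.symm), one_mul, one_mul] at h1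
  exact hab h1

section

variable {G : Type*} [Group G] [TopologicalSpace G] [IsTopologicalGroup G]

/-- A nontrivial element of a pro-`p` group becomes central of order `p` in a finite quotient. -/
theorem IsProP.exists_open_normal_central {p : ℕ} (hp : p.Prime) (hG : IsProP p G) {u : G}
    (hu : u ≠ 1) : ∃ S : Subgroup G, S.Normal ∧ IsOpen (S : Set G) ∧ u ∉ S ∧ u ^ p ∈ S ∧
      ∀ g, ⁅u, g⁆ ∈ S := by
  have := hG.compactSpace
  have := hG.totallyDisconnectedSpace
  have := Fact.mk hp
  classical
  -- Take S of least index among the open normal subgroups avoiding u. Enlarging S by a central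
  -- element z of order p of G ⧸ S must then capture u, so u is a power of z modulo S.
  have hex : ∃ n : ℕ, ∃ S : Subgroup G, S.Normal ∧ IsOpen (S : Set G) ∧ u ∉ S ∧ S.index = n := by
    obtain ⟨S, hS, hSo, -, huS⟩ :=
      exists_open_normal_ge_notMem (N := (⊥ : Subgroup G)) isClosed_singleton hu
    exact ⟨_, S, hS, hSo, huS, rfl⟩
  obtain ⟨S, hS, hSo, huS, hSi⟩ := Nat.find_spec hex
  have := finite_quotient_of_isOpen S hSo
  have hfi : S.FiniteIndex := finiteIndex_of_finite_quotient
  have hP := hG.isPGroup_quotient S hSo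
  have hnt : Nontrivial (G ⧸ S) := QuotientGroup.nontrivial_iff.mpr fun e => huS (e ▸ mem_top u)
  have hcnt := hP.center_nontrivial
  have hdvd : p ∣ Nat.card (center (G ⧸ S)) :=
    (hP.to_subgroup (center (G ⧸ S))).card_eq_or_dvd.resolve_left Finite.one_lt_card.ne'
  obtain ⟨⟨z, hzc⟩, hz⟩ := exists_prime_orderOf_dvd_card' p hdvd
  have hz1 : z ≠ 1 := by
    rintro rfl
    have : orderOf (1 : center (G ⧸ S)) = p := hz
    rw [orderOf_one] at this
    exact hp.one_lt.ne this
  have hzp : z ^ p = 1 := by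
    have := pow_orderOf_eq_one (⟨z, hzc⟩ : center (G ⧸ S))
    rw [hz] at this
    exact congrArg Subtype.val this
  have hle : zpowers z ≤ center (G ⧸ S) := zpowers_le.mpr hzc
  have hzn : (zpowers z).Normal := ⟨fun n hn g => by
    rw [mem_center_iff.mp (hle hn) g, mul_inv_cancel_right]; exact hn⟩
  have hSS : S ≤ (zpowers z).comap (QuotientGroup.mk' S) := fun s hs => by
    rw [mem_comap, QuotientGroup.mk'_apply, (QuotientGroup.eq_one_iff s).mpr hs]
    exact one_mem _
  have huz : (QuotientGroup.mk u : G ⧸ S) ∈ zpowers z := by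
    by_contra hcon
    have hlt : S < (zpowers z).comap (QuotientGroup.mk' S) := by
      refine lt_of_le_of_ne hSS fun e => hz1 ?_
      obtain ⟨y, rfl⟩ := QuotientGroup.mk_surjective z
      refine (QuotientGroup.eq_one_iff y).mpr ?_
      rw [e]
      exact mem_zpowers _
    have hmin := Nat.find_min' hex ⟨(zpowers z).comap (QuotientGroup.mk' S), inferInstance,
      isOpen_mono hSS hSo, hcon, rfl⟩
    rw [← hSi] at hmin
    exact absurd (index_strictAnti hlt) (not_lt.mpr hmin)
  refine ⟨S, hS, hSo, huS, ?_, fun g => ?_⟩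
  · obtain ⟨i, hi⟩ := huz
    have hi : z ^ i = QuotientGroup.mk u := hi
    rw [← QuotientGroup.eq_one_iff, QuotientGroup.mk_pow, ← hi, ← zpow_natCast, ← zpow_mul,
      mul_comm, zpow_mul, zpow_natCast, hzp, one_zpow]
  · have : ⁅(QuotientGroup.mk u : G ⧸ S), QuotientGroup.mk g⁆ = 1 :=
      commutatorElement_eq_one_iff_commute.mpr (mem_center_iff.mp (hle huz) _).symm
    exact (QuotientGroup.eq_one_iff ⁅u, g⁆).mp this

/-- Centralizers modulo the closed subgroup E are closed, so commuting generators modulo E make the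
whole quotient abelian. -/
theorem commutatorElement_mem_of_generators {a b : G}
    (hgen : (Subgroup.closure {a, b}).topologicalClosure = ⊤) {E : Subgroup G} [E.Normal]
    (hE : IsClosed (E : Set G)) (hab : ⁅a, b⁆ ∈ E) (g h : G) : ⁅g, h⁆ ∈ E := by
  let C : G → Subgroup G := fun x =>
    (centralizer {(QuotientGroup.mk x : G ⧸ E)}).comap (QuotientGroup.mk' E)
  have hC : ∀ g x, g ∈ C x ↔ ⁅g, x⁆ ∈ E := fun g x => by
    rw [mem_comap, mem_centralizer_singleton_iff, ← commute_iff_eq,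
      ← commutatorElement_eq_one_iff_commute, ← QuotientGroup.eq_one_iff]
    rfl
  have hsymm : ∀ g x, g ∈ C x → x ∈ C g := fun g x hgx => by
    rw [hC] at hgx ⊢
    rw [← commutatorElement_inv]
    exact inv_mem hgx
  have hclosed : ∀ x, IsClosed (C x : Set G) := fun x => by
    have : (C x : Set G) = (fun g => ⁅g, x⁆) ⁻¹' E := Set.ext fun g => hC g x
    rw [this]
    refine hE.preimage ?_
    simp only [commutatorElement_def]
    fun_prop
  have htop : ∀ x, a ∈ C x → b ∈ C x → ∀ g, g ∈ C x := fun x ha hb g => by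
    have hle : (Subgroup.closure {a, b}).topologicalClosure ≤ C x :=
      topologicalClosure_minimal _ ((closure_le _).mpr (Set.insert_subset ha
        (Set.singleton_subset_iff.mpr hb))) (hclosed x)
    exact hle (hgen ▸ mem_top g)
  have hself : ∀ x, x ∈ C x := fun x => (hC x x).mpr (by rw [commutatorElement_self]; exact one_mem E)
  have hab' : a ∈ C b := (hC a b).mpr hab
  exact (hC g h).mp (htop h (hsymm _ _ (htop a (hself a) (hsymm _ _ hab') h))
    (hsymm _ _ (htop b hab' (hself b) h)) g)

/-- A nonabelian pro-`p` group generated by `a` and `b` with torsion-free abelianization has a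
finite quotient of Heisenberg type. -/
theorem IsProP.exists_heisenberg_quotient {p : ℕ} (hp : p.Prime) (hG : IsProP p G) {a b : G}
    (hgen : (Subgroup.closure {a, b}).topologicalClosure = ⊤) (hab : ⁅a, b⁆ ≠ 1)
    (htf : ∀ x : G, x ^ p ∈ (commutator G).topologicalClosure →
      x ∈ (commutator G).topologicalClosure) :
    ∃ R : Subgroup G, R.Normal ∧ IsOpen (R : Set G) ∧ ⁅a, b⁆ ∉ R ∧ a ^ p ∈ R ∧ b ^ p ∈ R ∧
      ⁅a, b⁆ ^ p ∈ R ∧ ∀ g, ⁅⁅a, b⁆, g⁆ ∈ R := by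
  have := hG.compactSpace
  have := hG.totallyDisconnectedSpace
  obtain ⟨S, hS, hSo, huS, hupS, hucS⟩ := hG.exists_open_normal_central hp hab
  obtain ⟨u, hu⟩ : ∃ u, ⁅a, b⁆ = u := ⟨_, rfl⟩
  obtain ⟨T, hT⟩ : ∃ T, (commutator G).topologicalClosure = T := ⟨_, rfl⟩
  have hTn : T.Normal := hT ▸ inferInstance
  have hTc : IsClosed (T : Set G) := hT ▸ isClosed_topologicalClosure _
  have hcommT : ∀ g h : G, ⁅g, h⁆ ∈ T := fun g h => by
    rw [← hT]
    exact le_topologicalClosure _ (commutator_mem_commutator (mem_top g) (mem_top h))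
  have huT : u ∈ T := hu ▸ hcommT a b
  rw [hT] at htf
  rw [hu] at huS hupS hucS ⊢
  let q : G →* G ⧸ S := QuotientGroup.mk' S
  have hq1 : ∀ x, q x = 1 ↔ x ∈ S := QuotientGroup.eq_one_iff
  have hqu : ∀ x, Commute (q u) x := fun x => by
    obtain ⟨g, rfl⟩ := QuotientGroup.mk'_surjective S x
    rw [← commutatorElement_eq_one_iff_commute]
    exact (hq1 ⁅u, g⁆).mpr (hucS g)
  have hqup : q u ^ p = 1 := by rw [← map_pow, hq1]; exact hupS
  have hqz : ∀ {y}, y ∈ zpowers (q u) → (∀ x, Commute y x) ∧ y ^ p = 1 := by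
    rintro _ ⟨i, rfl⟩
    refine ⟨fun x => (hqu x).zpow_left i, ?_⟩
    change (q u ^ i) ^ p = 1
    rw [← zpow_natCast, ← zpow_mul, mul_comm, zpow_mul, zpow_natCast, hqup, one_zpow]
  have hzn : (zpowers (q u)).Normal := ⟨fun n hn g => by
    rw [← ((hqz hn).1 g).eq, mul_inv_cancel_right]; exact hn⟩
  have hSS : S ≤ (zpowers (q u)).comap q := fun s hs => by
    rw [mem_comap, (hq1 s).mpr hs]
    exact one_mem _
  have hS'c : IsClosed ((zpowers (q u)).comap q : Set G) :=
    isClosed_of_isOpen _ (isOpen_mono hSS hSo)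
  have hcommS : ∀ g h, ⁅g, h⁆ ∈ (zpowers (q u)).comap q :=
    commutatorElement_mem_of_generators hgen hS'c (by rw [hu]; exact mem_zpowers _)
  have hTS : T ≤ (zpowers (q u)).comap q := by
    rw [← hT]
    exact topologicalClosure_minimal _ (commutator_le.mpr fun g _ h _ => hcommS g h) hS'c
  let r : G →* G ⧸ (S ⊓ T) := QuotientGroup.mk' (S ⊓ T)
  have hr1 : ∀ x, r x = 1 ↔ x ∈ S ⊓ T := QuotientGroup.eq_one_iff
  -- p-th powers are central modulo S ⊓ T: modulo S every commutator is a power of u, hence central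
  -- of exponent p, and T contains all commutators.
  have hrpow : ∀ x y, Commute (r x ^ p) (r y) := fun x y => by
    rw [← map_pow, ← commutatorElement_eq_one_iff_commute, ← map_commutatorElement, hr1]
    refine ⟨?_, hcommT _ _⟩
    have hz := hqz (hcommS x y)
    rw [map_commutatorElement] at hz
    refine (hq1 _).mp ?_
    rw [map_commutatorElement, map_pow, commutatorElement_eq_one_iff_commute]
    exact commute_pow_of_commutatorElement_pow_eq_one (hz.1 _) hz.2
  obtain ⟨A, hA⟩ : ∃ A, (zpowers a).topologicalClosure = A := ⟨_, rfl⟩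
  obtain ⟨B, hB⟩ : ∃ B, (zpowers b).topologicalClosure = B := ⟨_, rfl⟩
  have hAcomm : ∀ x ∈ A, ∀ y ∈ A, Commute x y := fun x hx y hy => by
    rw [← hA] at hx hy
    exact commute_of_mem_topologicalClosure_zpowers hx hy
  have hBcomm : ∀ x ∈ B, ∀ y ∈ B, Commute x y := fun x hx y hy => by
    rw [← hB] at hx hy
    exact commute_of_mem_topologicalClosure_zpowers hx hy
  -- P kills a ^ p and b ^ p modulo S ⊓ T. Centrality of p-th powers makes it a normal subgroup;
  -- describing its elements by α and β allows the test whether u ∈ P.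
  let P : Subgroup G :=
    { carrier := {g | ∃ α ∈ A, ∃ β ∈ B, r g = r α ^ p * r β ^ p}
      one_mem' := ⟨1, one_mem A, 1, one_mem B, by simp⟩
      mul_mem' := by
        rintro x y ⟨α, hα, β, hβ, hx⟩ ⟨α', hα', β', hβ', hy⟩
        refine ⟨α * α', mul_mem hα hα', β * β', mul_mem hβ hβ', ?_⟩
        rw [map_mul, hx, hy, map_mul, map_mul, ((hAcomm α hα α' hα').map r).mul_pow,
          ((hBcomm β hβ β' hβ').map r).mul_pow, mul_assoc, mul_assoc,
          ← mul_assoc (r β ^ p), ((hrpow β α').pow_right p).eq, mul_assoc]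
      inv_mem' := by
        rintro x ⟨α, hα, β, hβ, hx⟩
        refine ⟨α⁻¹, inv_mem hα, β⁻¹, inv_mem hβ, ?_⟩
        rw [map_inv, hx, mul_inv_rev, map_inv, map_inv, inv_pow, inv_pow,
          ((hrpow β α).pow_right p).inv_inv.eq] }
  have hMP : S ⊓ T ≤ P := fun x hx =>
    ⟨1, one_mem A, 1, one_mem B, by rw [(hr1 x).mpr hx]; simp⟩
  have haP : a ^ p ∈ P :=
    ⟨a, hA ▸ le_topologicalClosure _ (mem_zpowers a), 1, one_mem B, by simp⟩
  have hbP : b ^ p ∈ P :=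
    ⟨1, one_mem A, b, hB ▸ le_topologicalClosure _ (mem_zpowers b), by simp⟩
  have hPn : P.Normal := ⟨by
    rintro x ⟨α, hα, β, hβ, hx⟩ g
    refine ⟨α, hα, β, hβ, ?_⟩
    rw [map_mul, map_mul, map_inv, hx, ← ((hrpow α g).mul_left (hrpow β g)).eq,
      mul_inv_cancel_right]⟩
  have hPc : IsClosed (P : Set G) := by
    have hAc : IsCompact (A : Set G) := (hA ▸ isClosed_topologicalClosure _ : IsClosed (A : Set G)).isCompact
    have hBc : IsCompact (B : Set G) := (hB ▸ isClosed_topologicalClosure _ : IsClosed (B : Set G)).isCompact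
    have hMc : IsCompact ((S ⊓ T : Subgroup G) : Set G) :=
      ((isClosed_of_isOpen S hSo).inter hTc).isCompact
    have himage : (P : Set G) = (fun z : G × G × G => z.1 ^ p * z.2.1 ^ p * z.2.2) ''
        ((A : Set G) ×ˢ (B : Set G) ×ˢ ((S ⊓ T : Subgroup G) : Set G)) := by
      ext x
      constructor
      · rintro ⟨α, hα, β, hβ, hx⟩
        refine ⟨(α, β, (α ^ p * β ^ p)⁻¹ * x), ⟨hα, hβ, ?_⟩, mul_inv_cancel_left _ _⟩
        refine (hr1 _).mp ?_
        rw [map_mul, map_inv, hx, map_mul, map_pow, map_pow, inv_mul_cancel]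
      · rintro ⟨⟨α, β, m⟩, ⟨hα, hβ, hm⟩, rfl⟩
        refine ⟨α, hα, β, hβ, ?_⟩
        simp only
        rw [map_mul, (hr1 m).mpr hm, map_mul, map_pow, map_pow, mul_one]
    rw [himage]
    exact ((hAc.prod (hBc.prod hMc)).image (by fun_prop)).isClosed
  -- If u ≡ α ^ p * β ^ p, then (α * β) ^ p ∈ T, so α * β ∈ T by torsion-freeness. Modulo S it is
  -- thus a power of the central element u, so α and β commute there and α ^ p * β ^ p = (α * β) ^ p
  -- = 1, forcing u ∈ S.
  have huP : u ∉ P := by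
    rintro ⟨α, hα, β, hβ, hx⟩
    have hm : (α ^ p * β ^ p)⁻¹ * u ∈ S ⊓ T := by
      rw [← hr1, map_mul, map_inv, hx, map_mul, map_pow, map_pow, inv_mul_cancel]
    have hαβT : α ^ p * β ^ p ∈ T := by
      have := mul_mem huT (inv_mem hm.2)
      simpa using this
    have hαβ : α * β ∈ T := by
      apply htf
      rw [← hT, ← QuotientGroup.eq_one_iff] at hαβT ⊢
      have e : ((α * β : G) : TopologicalAbelianization G) ^ p =
          (α : TopologicalAbelianization G) ^ p * (β : TopologicalAbelianization G) ^ p :=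
        mul_pow (α : TopologicalAbelianization G) (β : TopologicalAbelianization G) p
      exact e.trans hαβT
    have hz := hqz (hTS hαβ)
    have hcomm : Commute (q α) (q β) := by
      have e : q α = q (α * β) * (q β)⁻¹ := by rw [map_mul, mul_inv_cancel_right]
      rw [e]
      exact (hz.1 _).mul_left (Commute.refl _).inv_left
    have h1 : q (α ^ p * β ^ p) = 1 := by
      rw [map_mul, map_pow, map_pow, ← hcomm.mul_pow, ← map_mul, hz.2]
    apply huS
    have h2 := mul_mem ((hq1 _).mp h1) hm.1
    rwa [mul_inv_cancel_left] at h2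
  obtain ⟨R, hR, hRo, hPR, huR⟩ := exists_open_normal_ge_notMem hPc huP
  exact ⟨R, hR, hRo, huR, hPR haP, hPR hbP, hPR (hMP ⟨hupS, pow_mem huT p⟩),
    fun g => hPR (hMP ⟨hucS g, hcommT u g⟩)⟩

end

/-! ### One factor is abelian -/

section

variable {G : Type*} [Group G] [TopologicalSpace G] [IsTopologicalGroup G]

theorem exists_isTopGen_generators (fin : Prop) [CompactSpace G] [T2Space G] (a b : G) :
    ∃ (H : Subgroup G) (a' b' : H), IsTopGen fin H ∧ (a' : G) = a ∧ (b' : G) = b ∧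
      (Subgroup.closure {a', b'}).topologicalClosure = ⊤ := by
  obtain ⟨H, hH⟩ : ∃ H, (Subgroup.closure {a, b}).topologicalClosure = H := ⟨_, rfl⟩
  have hgen : IsTopGen fin H := ⟨{a, b}, fun _ => by simp, hH⟩
  have hsub : ({a, b} : Set G) ⊆ H := hH ▸ subset_closure.trans (le_topologicalClosure _)
  have hc : CompactSpace H := isCompact_iff_compactSpace.mp hgen.isClosed.isCompact
  refine ⟨H, ⟨a, hsub (by simp)⟩, ⟨b, hsub (by simp)⟩, hgen, rfl, rfl, ?_⟩
  apply map_injective H.subtype_injective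
  rw [map_topologicalClosure H.subtype continuous_subtype_val, MonoidHom.map_closure,
    Set.image_pair, ← MonoidHom.range_eq_map, range_subtype]
  exact hH

theorem HasCommutatorRoots.mem_topologicalClosure_commutator {fin : Prop} {p : ℕ}
    (h : HasCommutatorRoots fin p G) {H : Subgroup G} (hH : IsTopGen fin H) (x : H)
    (hx : x ^ p ∈ (commutator H).topologicalClosure) : x ∈ (commutator H).topologicalClosure := by
  rw [topologicalClosure_commutator_coe] at hx ⊢
  exact h H hH x x.2 hx

theorem isTorsionFreeAbelian_of_pow_eq_one {p : ℕ} (hp : p.Prime)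
    (hG : IsProP p G) (hcomm : ∀ x y : G, x * y = y * x) (h : ∀ x : G, x ^ p = 1 → x = 1) :
    IsTorsionFreeAbelian G := by
  have := hG.totallyDisconnectedSpace
  refine ⟨hcomm, fun x hx => ?_⟩
  obtain ⟨n, hn, hxn⟩ := isOfFinOrder_iff_pow_eq_one.mp hx
  exact mem_bot.mp (mem_of_pow_mem hp hG (M := ⊥) isClosed_singleton h hn.ne' hxn)

end

variable {G₁ G₂ : Type*} [Group G₁] [TopologicalSpace G₁] [IsTopologicalGroup G₁]
  [Group G₂] [TopologicalSpace G₂] [IsTopologicalGroup G₂]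

theorem not_hasFrattiniRoots_prod_of_generators {fin : Prop} {p : ℕ} (hp : p.Prime)
    (h₁ : IsProP p G₁) (h₂ : IsProP p G₂) {a b : G₁} {c d : G₂}
    (hgen₁ : (Subgroup.closure {a, b}).topologicalClosure = ⊤)
    (hgen₂ : (Subgroup.closure {c, d}).topologicalClosure = ⊤) (hab : ⁅a, b⁆ ≠ 1) (hcd : ⁅c, d⁆ ≠ 1)
    (htf₁ : ∀ x : G₁, x ^ p ∈ (commutator G₁).topologicalClosure →
      x ∈ (commutator G₁).topologicalClosure)
    (htf₂ : ∀ x : G₂, x ^ p ∈ (commutator G₂).topologicalClosure →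
      x ∈ (commutator G₂).topologicalClosure) : ¬ HasFrattiniRoots fin p (G₁ × G₂) := by
  intro h
  obtain ⟨R₁, hn₁, ho₁, hu, ha, hb, hup, huc⟩ := h₁.exists_heisenberg_quotient hp hgen₁ hab htf₁
  obtain ⟨R₂, hn₂, ho₂, hv, hc, hd, hvp, hvc⟩ := h₂.exists_heisenberg_quotient hp hgen₂ hcd htf₂
  let q₁ : G₁ →* G₁ ⧸ R₁ := QuotientGroup.mk' R₁
  let q₂ : G₂ →* G₂ ⧸ R₂ := QuotientGroup.mk' R₂
  have hq₁ : ∀ x, q₁ x = 1 ↔ x ∈ R₁ := QuotientGroup.eq_one_iff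
  have hq₂ : ∀ x, q₂ x = 1 ↔ x ∈ R₂ := QuotientGroup.eq_one_iff
  -- The third generator vanishes modulo R₁ × R₂, yet its commutator with (b, d) turns (a, c) ^ p
  -- into the p-th power of (b * a * b⁻¹, c). Root extraction then puts (⁅a, b⁆, 1) into K.
  obtain ⟨K, hK⟩ : ∃ K : Subgroup (G₁ × G₂),
    (Subgroup.closure {(a, c), (b, d), (a ^ p, 1)}).topologicalClosure = K := ⟨_, rfl⟩
  have hKgen : IsTopGen fin K := hK ▸ IsTopGen.of_finite (Set.toFinite _)
  have hsub : ({(a, c), (b, d), (a ^ p, 1)} : Set (G₁ × G₂)) ⊆ K :=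
    hK ▸ subset_closure.trans (le_topologicalClosure _)
  have hk₁ : (a, c) ∈ K := hsub (by simp)
  have hk₂ : (b, d) ∈ K := hsub (by simp)
  have hk₃ : (a ^ p, 1) ∈ K := hsub (by simp)
  have hyK : (b * a * b⁻¹, c) ∈ K := by
    apply h K hKgen
    have e : ((b * a * b⁻¹, c) : G₁ × G₂) ^ p = ⁅(b, d), (a ^ p, 1)⁆ * (a, c) ^ p := by
      ext
      · simp [commutatorElement_def, conj_pow]
      · simp [commutatorElement_def]
    rw [e]
    exact mul_mem (commutator_le_frattiniFun p K (commutator_mem_commutator hk₂ hk₃))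
      (pow_mem_frattiniFun hk₁)
  have huK : ((⁅a, b⁆, 1) : G₁ × G₂) ∈ K := by
    have e : ((⁅a, b⁆, 1) : G₁ × G₂) = (a, c) * (b * a * b⁻¹, c)⁻¹ := by
      ext
      · simp [commutatorElement_def, mul_assoc]
      · simp
    rw [e]
    exact mul_mem hk₁ (inv_mem hyK)
  have hle : K ≤ (Subgroup.closure {(q₁ a, q₂ c), (q₁ b, q₂ d)}).comap (q₁.prodMap q₂) := by
    rw [← hK]
    refine topologicalClosure_minimal _ ((closure_le _).mpr ?_)
      (isClosed_of_isOpen _ (isOpen_mono (H₁ := R₁.prod R₂) (fun x hx => ?_) ?_))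
    · rintro _ (rfl | rfl | rfl)
      · exact subset_closure (by simp)
      · exact subset_closure (by simp)
      · have e : q₁.prodMap q₂ (a ^ p, 1) = 1 :=
          Prod.ext ((hq₁ _).mpr ha) (map_one q₂)
        rw [SetLike.mem_coe, mem_comap, e]
        exact one_mem _
    · have e : q₁.prodMap q₂ x = 1 := Prod.ext ((hq₁ _).mpr hx.1) ((hq₂ _).mpr hx.2)
      rw [mem_comap, e]
      exact one_mem _
    · rw [coe_prod]
      exact ho₁.prod ho₂
  have hmem := hle huK
  have e : q₁.prodMap q₂ (⁅a, b⁆, 1) = (⁅q₁ a, q₁ b⁆, 1) :=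
    Prod.ext (map_commutatorElement q₁ a b) (map_one q₂)
  rw [mem_comap, e] at hmem
  refine commutator_one_notMem_closure_pair hp ?_ ?_ ?_ ?_ (fun g => ?_) (fun g => ?_) ?_ ?_ ?_ ?_
    hmem
  · rw [← map_pow, hq₁]; exact ha
  · rw [← map_pow, hq₁]; exact hb
  · rw [← map_pow, hq₂]; exact hc
  · rw [← map_pow, hq₂]; exact hd
  · obtain ⟨g, rfl⟩ := QuotientGroup.mk'_surjective R₁ g
    rw [← commutatorElement_eq_one_iff_commute, ← map_commutatorElement]
    exact (hq₁ ⁅⁅a, b⁆, g⁆).mpr (huc g)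
  · obtain ⟨g, rfl⟩ := QuotientGroup.mk'_surjective R₂ g
    rw [← commutatorElement_eq_one_iff_commute, ← map_commutatorElement]
    exact (hq₂ ⁅⁅c, d⁆, g⁆).mpr (hvc g)
  · rw [← map_commutatorElement, ← map_pow, hq₁]; exact hup
  · rw [← map_commutatorElement, ← map_pow, hq₂]; exact hvp
  · rw [← map_commutatorElement, Ne, hq₁]; exact hu
  · rw [← map_commutatorElement, Ne, hq₂]; exact hv

/-- Two non-commuting pairs generate closed subgroups that inherit all hypotheses, which reduces to
two-generated factors. -/
theorem HasFrattiniRoots.comm_or_comm {fin : Prop} {p : ℕ} (hp : p.Prime)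
    (h₁ : IsProP p G₁) (h₂ : IsProP p G₂) (h : HasFrattiniRoots fin p (G₁ × G₂))
    (hr₁ : HasCommutatorRoots fin p G₁) (hr₂ : HasCommutatorRoots fin p G₂) :
    (∀ x y : G₁, x * y = y * x) ∨ ∀ x y : G₂, x * y = y * x := by
  have := h₁.compactSpace
  have := h₂.compactSpace
  have := h₁.totallyDisconnectedSpace
  have := h₂.totallyDisconnectedSpace
  by_contra! hcon
  obtain ⟨⟨a, b, hab⟩, c, d, hcd⟩ := hcon
  obtain ⟨H₁, a, b, hH₁, rfl, rfl, hgen₁⟩ := exists_isTopGen_generators fin a b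
  obtain ⟨H₂, c, d, hH₂, rfl, rfl, hgen₂⟩ := exists_isTopGen_generators fin c d
  have hp₁ := h₁.subgroup hp hH₁.isClosed
  have hp₂ := h₂.subgroup hp hH₂.isClosed
  have := hp₁.compactSpace
  have := hp₂.compactSpace
  refine not_hasFrattiniRoots_prod_of_generators (fin := fin) hp hp₁ hp₂ hgen₁ hgen₂
    (fun e => hab ?_) (fun e => hcd ?_) (hr₁.mem_topologicalClosure_commutator hH₁)
    (hr₂.mem_topologicalClosure_commutator hH₂)
    (h.of_injective (H₁.subtype.prodMap H₂.subtype)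
      (continuous_subtype_val.prodMap continuous_subtype_val)
      (H₁.subtype_injective.prodMap H₂.subtype_injective))
  · exact congrArg Subtype.val (commutatorElement_eq_one_iff_mul_comm.mp e)
  · exact congrArg Subtype.val (commutatorElement_eq_one_iff_mul_comm.mp e)

/-! ### The two directions combined -/

theorem hasCommutatorRoots_prod {fin : Prop} {p : ℕ} (hp : p.Prime)
    (h₁ : IsProP p G₁) (h₂ : IsProP p G₂)
    (h : (IsTorsionFreeAbelian G₁ ∧ HasCommutatorRoots fin p G₂) ∨
      (IsTorsionFreeAbelian G₂ ∧ HasCommutatorRoots fin p G₁)) :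
    HasCommutatorRoots fin p (G₁ × G₂) := by
  have := h₁.compactSpace
  have := h₂.compactSpace
  have := h₁.totallyDisconnectedSpace
  have := h₂.totallyDisconnectedSpace
  rcases h with ⟨⟨hc, ht⟩, h⟩ | ⟨⟨hc, ht⟩, h⟩
  · exact h.prod hc fun x hx => ht x (isOfFinOrder_iff_pow_eq_one.mpr ⟨p, hp.pos, hx⟩)
  · exact (h.prod hc fun x hx => ht x (isOfFinOrder_iff_pow_eq_one.mpr ⟨p, hp.pos, hx⟩)).of_injective
      (MulEquiv.prodComm : G₁ × G₂ ≃* G₂ × G₁).toMonoidHom continuous_swap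
      (MulEquiv.prodComm : G₁ × G₂ ≃* G₂ × G₁).injective

theorem hasFrattiniRoots_prod_iff {fin : Prop} {p : ℕ} (hp : p.Prime) [Nontrivial G₁]
    [Nontrivial G₂] (h₁ : IsProP p G₁) (h₂ : IsProP p G₂) :
    HasFrattiniRoots fin p (G₁ × G₂) ↔
      (IsTorsionFreeAbelian G₁ ∧ HasCommutatorRoots fin p G₂) ∨
        (IsTorsionFreeAbelian G₂ ∧ HasCommutatorRoots fin p G₁) := by
  have := h₁.compactSpace
  have := h₂.compactSpace
  have := h₁.totallyDisconnectedSpace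
  have := h₂.totallyDisconnectedSpace
  refine ⟨fun h => ?_, fun h => (hasCommutatorRoots_prod hp h₁ h₂ h).hasFrattiniRoots hp
    (h₁.prod hp h₂)⟩
  have hs : HasFrattiniRoots fin p (G₂ × G₁) :=
    h.of_injective (MulEquiv.prodComm : G₂ × G₁ ≃* G₁ × G₂).toMonoidHom continuous_swap
      (MulEquiv.prodComm : G₂ × G₁ ≃* G₁ × G₂).injective
  have hr₂ := h.hasCommutatorRoots_right hp h₁ h₂
  have hr₁ := hs.hasCommutatorRoots_right hp h₂ h₁
  rcases h.comm_or_comm hp h₁ h₂ hr₁ hr₂ with hc | hc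
  · refine Or.inl ⟨isTorsionFreeAbelian_of_pow_eq_one hp h₁ hc fun x hx => ?_, hr₂⟩
    exact congrArg Prod.fst (h.eq_one_of_pow_eq_one (g := (x, 1)) (Prod.ext hx (one_pow p)))
  · refine Or.inr ⟨isTorsionFreeAbelian_of_pow_eq_one hp h₂ hc fun x hx => ?_, hr₁⟩
    exact congrArg Prod.snd (h.eq_one_of_pow_eq_one (g := (1, x)) (Prod.ext (one_pow p) hx))

end ProP

theorem theoremA (p : ℕ) (hp : p.Prime)
    {G₁ : Type*} [Group G₁] [TopologicalSpace G₁] [IsTopologicalGroup G₁] [Nontrivial G₁]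
    {G₂ : Type*} [Group G₂] [TopologicalSpace G₂] [IsTopologicalGroup G₂] [Nontrivial G₂]
    (h₁ : ProP.IsProP p G₁) (h₂ : ProP.IsProP p G₂) :
    ((ProP.IsFrattiniResistant p (G₁ × G₂) ↔
        (ProP.IsTorsionFreeAbelian G₁ ∧ ProP.IsLocallyAbsolutelyTorsionFree G₂) ∨
        (ProP.IsTorsionFreeAbelian G₂ ∧ ProP.IsLocallyAbsolutelyTorsionFree G₁)) ∧
      (ProP.IsFrattiniResistant p (G₁ × G₂) →
        ProP.IsLocallyAbsolutelyTorsionFree (G₁ × G₂))) ∧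
    ((ProP.IsStronglyFrattiniResistant p (G₁ × G₂) ↔
        (ProP.IsTorsionFreeAbelian G₁ ∧ ProP.IsAbsolutelyTorsionFree G₂) ∨
        (ProP.IsTorsionFreeAbelian G₂ ∧ ProP.IsAbsolutelyTorsionFree G₁)) ∧
      (ProP.IsStronglyFrattiniResistant p (G₁ × G₂) →
        ProP.IsAbsolutelyTorsionFree (G₁ × G₂))) := by

  have := h₁.compactSpace
  have := h₂.compactSpace
  have := h₁.totallyDisconnectedSpace
  have := h₂.totallyDisconnectedSpace
  have h := h₁.prod hp h₂
  rw [ProP.isFrattiniResistant_iff, ProP.isStronglyFrattiniResistant_iff,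
    ProP.isLocallyAbsolutelyTorsionFree_iff hp h₁, ProP.isLocallyAbsolutelyTorsionFree_iff hp h₂,
    ProP.isLocallyAbsolutelyTorsionFree_iff hp h, ProP.isAbsolutelyTorsionFree_iff hp h₁,
    ProP.isAbsolutelyTorsionFree_iff hp h₂, ProP.isAbsolutelyTorsionFree_iff hp h]
  have key (fin : Prop) := ProP.hasFrattiniRoots_prod_iff (fin := fin) hp h₁ h₂
  exact ⟨⟨key True, fun hr => ProP.hasCommutatorRoots_prod hp h₁ h₂ ((key True).mp hr)⟩,
    key False, fun hr => ProP.hasCommutatorRoots_prod hp h₁ h₂ ((key False).mp hr)⟩
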